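/- All operators are bounded linear operators on complex Hilbert spaces. An operator $T$ on $H$ is *subnormal* if it is unitarily equivalent to the restriction of a normal operator to a closed invariant subspace. If $T = U|T|$ is the polar decomposition of $T$ (with $|T| = (T^*T)^{1/2}$ and $U$ the partial isometry with $\ker U = \ker T$), the *mean transform* of $T$ is the operator $\hat T = \tfrac12\,(U|T| + |T|U)$. For a bounded sequence $\alpha = (\alpha_n)_{n\ge 0}$ of positive real numbers, the weighted shift $W_\alpha$ is the operator on $\ell^2$ with $W_\alpha e_n = \alpha_n e_{n+1}$ for $n \ge 0$, where $(e_n)_{n\ge0}$ is the standard basis. Such a weighted shift $W_\alpha$ is *moment infinitely divisible* if, for every real $t > 0$, the weighted shift with weights $\alpha_n^t$ $(n \ge 0)$ is subnormal. The *Bergman shift* is the weighted shift with weights $\sqrt{\frac{n+1}{n+2}}$ $(n \ge 0)$, and its *Schur square* is the weighted shift whose weights are the squares of these, $\frac{n+1}{n+2}$ $(n \ge 0)$. **Corollary 3.8.** The mean transform of the Bergman shift and the mean transform of the Schur square of the Bergman shift are both weighted shifts (with bounded positive weights) that are moment infinitely divisible, and hence subnormal. -/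

import Mathlib

/-! ## Subnormal operators -/

section Operators

universe u

variable {H : Type u} [NormedAddCommGroup H] [InnerProductSpace ℂ H] [CompleteSpace H]

/-- A bounded operator `T` on a complex Hilbert space `H` is subnormal if it is unitarily equivalent
to the restriction of a normal operator `N`, acting on some complex Hilbert space `K`, to a closed
invariant subspace. The subspace is the range of the linear isometry `V : H → K`, which is closed
because `H` is complete, and which is invariant under `N` because `N V = V T`. -/
def IsSubnormalOperator (T : H →L[ℂ] H) : Prop :=
  ∃ (K : Type u) (_ : NormedAddCommGroup K) (_ : InnerProductSpace ℂ K) (_ : CompleteSpace K)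
    (N : K →L[ℂ] K) (V : H →ₗᵢ[ℂ] K), IsStarNormal N ∧ ∀ x : H, N (V x) = V (T x)

/-! ## Polar decomposition and the mean transform -/

/-- `T = U |T|` is the polar decomposition of `T`: here `|T| = (T* T)^(1/2)`, and `U` is the
partial isometry (isometric on the orthogonal complement of its kernel) with the same kernel
as `T`. -/
structure IsPolarDecomposition (T U : H →L[ℂ] H) : Prop where
  eq_mul : T = U * CFC.abs T
  ker_eq : U.ker = T.ker
  norm_map : ∀ x ∈ (U.ker)ᗮ, ‖U x‖ = ‖x‖

theorem norm_cfcAbs_apply (T : H →L[ℂ] H) (x : H) : ‖CFC.abs T x‖ = ‖T x‖ := by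
  have hsa : star (CFC.abs T) = CFC.abs T := (CFC.abs_nonneg T).isSelfAdjoint
  have h : star (CFC.abs T) * CFC.abs T = star T * T := by rw [hsa, CFC.abs_mul_abs]
  have h1 : inner ℂ (CFC.abs T x) (CFC.abs T x) = inner ℂ (T x) (T x) := by
    have h2 := congrArg (fun A : H →L[ℂ] H => inner ℂ (A x) x) h
    simpa [ContinuousLinearMap.star_eq_adjoint, ContinuousLinearMap.adjoint_inner_left] using h2
  have h3 : ‖CFC.abs T x‖ ^ 2 = ‖T x‖ ^ 2 := by
    rw [← inner_self_eq_norm_sq (𝕜 := ℂ) (CFC.abs T x), ← inner_self_eq_norm_sq (𝕜 := ℂ) (T x), h1]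
  exact (sq_eq_sq₀ (norm_nonneg _) (norm_nonneg _)).1 h3

theorem orthogonal_range_cfcAbs (T : H →L[ℂ] H) : (CFC.abs T).rangeᗮ = T.ker := by
  have hsa : ContinuousLinearMap.adjoint (CFC.abs T) = CFC.abs T :=
    (CFC.abs_nonneg T).isSelfAdjoint
  rw [ContinuousLinearMap.orthogonal_range, hsa]
  ext x
  have := norm_cfcAbs_apply T x
  simp only [LinearMap.mem_ker, ContinuousLinearMap.coe_coe]
  rw [← norm_eq_zero, this, norm_eq_zero]

/-- Every bounded operator on a complex Hilbert space has exactly one polar decomposition. -/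
theorem existsUnique_isPolarDecomposition (T : H →L[ℂ] H) :
    ∃! U : H →L[ℂ] H, IsPolarDecomposition T U := by
  set P : H →L[ℂ] H := CFC.abs T with hP
  let K : Submodule ℂ H := P.range.topologicalClosure
  have hKc : IsClosed (K : Set H) := Submodule.isClosed_topologicalClosure _
  have : CompleteSpace K := hKc.completeSpace_coe
  have hKo : Kᗮ = T.ker := by
    rw [Submodule.orthogonal_closure, hP, orthogonal_range_cfcAbs]
  have hKK : (T.ker)ᗮ = K := by
    rw [← hKo, Submodule.orthogonal_orthogonal]
  have hmem : ∀ x, P x ∈ K := fun x =>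
    Submodule.le_topologicalClosure _ (LinearMap.mem_range_self _ x)
  let e : H →ₗ[ℂ] K := (P : H →ₗ[ℂ] H).codRestrict K hmem
  have hdense : DenseRange e := by
    intro y
    rw [Metric.mem_closure_iff]
    intro ε hε
    have hy : (y : H) ∈ closure (P.range : Set H) := by
      rw [← Submodule.topologicalClosure_coe]; exact y.2
    obtain ⟨z, ⟨x, rfl⟩, hx⟩ := Metric.mem_closure_iff.1 hy ε hε
    exact ⟨e x, ⟨x, rfl⟩, hx⟩
  have hnorm : ∀ x, ‖T x‖ = ‖e x‖ := fun x => (norm_cfcAbs_apply T x).symm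
  let f : K →L[ℂ] H := (T : H →ₗ[ℂ] H).extendOfNorm e
  have hf : ∀ x, f (e x) = T x := fun x =>
    LinearMap.extendOfNorm_eq hdense ⟨1, fun x => by rw [one_mul]; exact (hnorm x).le⟩ x
  have hfn : ∀ y, ‖f y‖ = ‖y‖ := by
    intro y
    refine hdense.induction_on (p := fun y => ‖f y‖ = ‖y‖) y
      (isClosed_eq (by fun_prop) (by fun_prop)) ?_
    intro x
    rw [hf, hnorm]
  have hUK : ∀ y : K, (f ∘L K.orthogonalProjectionOnto) (y : H) = f y := by
    intro y
    simp
  have hker : (f ∘L K.orthogonalProjectionOnto).ker = T.ker := by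
    rw [← hKo]
    ext x
    rw [← Submodule.orthogonalProjectionOnto_eq_zero_iff]
    simp only [LinearMap.mem_ker, ContinuousLinearMap.coe_coe, ContinuousLinearMap.comp_apply]
    rw [← norm_eq_zero, hfn, norm_eq_zero]
  refine ⟨f ∘L K.orthogonalProjectionOnto, ⟨?_, hker, ?_⟩, ?_⟩
  · ext x
    exact ((hUK (e x)).trans (hf x)).symm
  · intro x hx
    rw [hker, hKK] at hx
    have := hUK ⟨x, hx⟩
    simp only at this
    rw [this, hfn]
    rfl
  · intro U hU
    have h1 : ∀ y : K, U y = f y := by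
      intro y
      refine hdense.induction_on (p := fun y : K => U y = f y) y
        (isClosed_eq (by fun_prop) (by fun_prop)) ?_
      intro x
      rw [hf]
      exact (congrArg (fun A : H →L[ℂ] H => A x) hU.eq_mul).symm
    ext x
    have hx : x - K.orthogonalProjectionOnto x ∈ U.ker := by
      rw [hU.ker_eq, ← hKo]
      exact Submodule.sub_starProjection_mem_orthogonal x
    have h2 : U x = U (K.orthogonalProjectionOnto x) := by
      have h3 : U (x - K.orthogonalProjectionOnto x) = 0 := hx
      rwa [map_sub, sub_eq_zero] at h3
    rw [h2, h1]
    rfl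

/-- The partial isometry `U` of the polar decomposition `T = U |T|`. -/
noncomputable def polarPartialIsometry (T : H →L[ℂ] H) : H →L[ℂ] H :=
  (existsUnique_isPolarDecomposition T).choose

theorem isPolarDecomposition_polarPartialIsometry (T : H →L[ℂ] H) :
    IsPolarDecomposition T (polarPartialIsometry T) :=
  (existsUnique_isPolarDecomposition T).choose_spec.1

/-- The mean transform `(U |T| + |T| U) / 2` of `T`, where `T = U |T|` is the polar
decomposition. -/
noncomputable def meanTransform (T : H →L[ℂ] H) : H →L[ℂ] H :=
  (1 / 2 : ℂ) • (polarPartialIsometry T * CFC.abs T + CFC.abs T * polarPartialIsometry T)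

end Operators

/-! ## Unilateral weighted shifts -/

/-- A bounded sequence of positive real numbers. -/
structure WeightSequence where
  /-- the weights -/
  weight : ℕ → ℝ
  pos : ∀ n, 0 < weight n
  bddAbove : BddAbove (Set.range weight)

namespace WeightSequence

/-- The sequence of the `t`-th powers of the weights, `t > 0`. -/
noncomputable def rpow (α : WeightSequence) (t : ℝ) (ht : 0 < t) : WeightSequence where
  weight n := α.weight n ^ t
  pos n := Real.rpow_pos_of_pos (α.pos n) t
  bddAbove := by
    obtain ⟨C, hC⟩ := α.bddAbove
    refine ⟨C ^ t, ?_⟩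
    rintro _ ⟨n, rfl⟩
    exact Real.rpow_le_rpow (α.pos n).le (hC ⟨n, rfl⟩) ht.le

/-- The Schur square: the weights are replaced by their squares. -/
noncomputable def schurSquare (α : WeightSequence) : WeightSequence where
  weight n := α.weight n ^ 2
  pos n := pow_pos (α.pos n) 2
  bddAbove := by
    obtain ⟨C, hC⟩ := α.bddAbove
    refine ⟨C ^ 2, ?_⟩
    rintro _ ⟨n, rfl⟩
    exact pow_le_pow_left₀ (α.pos n).le (hC ⟨n, rfl⟩) 2

/-- The weights `√((n + 1) / (n + 2))` of the Bergman shift. -/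
noncomputable def bergman : WeightSequence where
  weight n := √(((n : ℝ) + 1) / ((n : ℝ) + 2))
  pos n := by positivity
  bddAbove := by
    refine ⟨1, ?_⟩
    rintro _ ⟨n, rfl⟩
    refine Real.sqrt_le_one.2 ?_
    rw [div_le_one (by positivity)]
    linarith

end WeightSequence

/-- The complex Hilbert space `ℓ²` of square-summable sequences indexed by `ℕ`. -/
abbrev EllTwo : Type := lp (fun _ : ℕ => ℂ) 2

/-- The sequence `(0, α₀ x₀, α₁ x₁, …)`. -/
def shiftFun (α : ℕ → ℝ) (x : ℕ → ℂ) : ℕ → ℂ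
  | 0 => 0
  | n + 1 => (α n : ℂ) * x n

theorem WeightSequence.exists_bound (α : WeightSequence) :
    ∃ C : ℝ, 0 ≤ C ∧ ∀ (x : EllTwo) (s : Finset ℕ),
      ∑ i ∈ s, ‖shiftFun α.weight x i‖ ^ (2 : ENNReal).toReal
        ≤ (C * ‖x‖) ^ (2 : ENNReal).toReal := by
  obtain ⟨C, hC⟩ := α.bddAbove
  have hC0 : 0 ≤ C := (α.pos 0).le.trans (hC ⟨0, rfl⟩)
  refine ⟨C, hC0, fun x s => ?_⟩
  have hx := lp.sum_rpow_le_norm_rpow (p := 2) (by norm_num) x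
  simp only [ENNReal.toReal_ofNat, Real.rpow_ofNat] at hx ⊢
  obtain ⟨N, hN⟩ := s.exists_nat_subset_range
  calc ∑ i ∈ s, ‖shiftFun α.weight x i‖ ^ 2
      ≤ ∑ i ∈ Finset.range (N + 1), ‖shiftFun α.weight x i‖ ^ 2 :=
        Finset.sum_le_sum_of_subset_of_nonneg
          (hN.trans (Finset.range_mono (Nat.le_succ N))) fun _ _ _ => by positivity
    _ = ∑ i ∈ Finset.range N, ‖(α.weight i : ℂ) * x i‖ ^ 2 := by
        rw [Finset.sum_range_succ']
        simp [shiftFun]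
    _ ≤ ∑ i ∈ Finset.range N, C ^ 2 * ‖x i‖ ^ 2 := by
        refine Finset.sum_le_sum fun i _ => ?_
        rw [norm_mul, mul_pow, Complex.norm_real, Real.norm_of_nonneg (α.pos i).le]
        have := pow_le_pow_left₀ (α.pos i).le (hC ⟨i, rfl⟩) 2
        gcongr
    _ ≤ (C * ‖x‖) ^ 2 := by
        rw [← Finset.mul_sum, mul_pow]
        have := hx (Finset.range N)
        gcongr

/-- The weighted shift `W_α` on `ℓ²`: it maps `(x₀, x₁, …)` to `(0, α₀ x₀, α₁ x₁, …)`, that is,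
`W_α e_n = α_n e_{n+1}`. -/
noncomputable def weightedShift (α : WeightSequence) : EllTwo →L[ℂ] EllTwo :=
  LinearMap.mkContinuousOfExistsBound
    { toFun := fun x => ⟨shiftFun α.weight x, by
        obtain ⟨C, -, hC⟩ := α.exists_bound
        exact memℓp_gen' (hC x)⟩
      map_add' := fun x y => by
        ext n
        change shiftFun α.weight (x + y : EllTwo) n
          = shiftFun α.weight x n + shiftFun α.weight y n
        cases n <;> simp [shiftFun, mul_add]
      map_smul' := fun c x => by
        ext n
        cases n <;> simp [shiftFun, mul_left_comm] }
    (by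
      obtain ⟨C, hC0, hC⟩ := α.exists_bound
      exact ⟨C, fun x => lp.norm_le_of_forall_sum_le (by norm_num) (by positivity) (hC x)⟩)

theorem weightedShift_single (α : WeightSequence) (n : ℕ) :
    weightedShift α (lp.single 2 n (1 : ℂ)) = (α.weight n : ℂ) • lp.single 2 (n + 1) (1 : ℂ) := by
  ext k
  change shiftFun α.weight (lp.single 2 n (1 : ℂ) : EllTwo) k
    = (α.weight n : ℂ) * (lp.single 2 (n + 1) (1 : ℂ) : EllTwo) k
  cases k with
  | zero => simp [shiftFun]
  | succ k =>
    by_cases h : k = n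
    · subst h
      simp [shiftFun]
    · simp [shiftFun, h]

/-- An operator on `ℓ²` is moment infinitely divisible if it is a weighted shift `W_β` with bounded
positive weights (which are then determined by the operator) and, for every `t > 0`, the shift with
weights `β_n ^ t` is subnormal. -/
def IsMomentInfinitelyDivisible (T : EllTwo →L[ℂ] EllTwo) : Prop :=
  ∃ β : WeightSequence, T = weightedShift β ∧
    ∀ (t : ℝ) (ht : 0 < t), IsSubnormalOperator (weightedShift (β.rpow t ht))

/-- The Bergman shift. -/
noncomputable def bergmanShift : EllTwo →L[ℂ] EllTwo :=
  weightedShift WeightSequence.bergman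

/-- The Schur square of the Bergman shift, that is, the weighted shift whose weights are the squares
`(n + 1) / (n + 2)` of those of the Bergman shift. -/
noncomputable def bergmanShiftSchurSquare : EllTwo →L[ℂ] EllTwo :=
  weightedShift WeightSequence.bergman.schurSquare

/-! Write `S` for the unilateral shift and `D` for the diagonal operator with entries `α n`. The
polar decomposition of `W_α` is `S D`, so its mean transform is the weighted shift with weights `(α
n + α (n + 1)) / 2` (`meanTransform_weightedShift`).

Everything then rests on Hausdorff moment sequences. They form a convex cone closed under products,
index shifts and pointwise limits, hence under power series with nonnegative coefficients whenever
these converge. If the weights are `1 - c n` with `c` such a sequence and `c 0 < 1`, then `d n =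
-log (1 - c n)` is again one. The moments of the shift with weights `(1 - c n) ^ t` are `exp (-2t ∑
k < n, d k)`, which `exp_neg_sum_range` shows to be a Hausdorff moment sequence. Berger's criterion
(`isSubnormalOperator_weightedShift`) gives subnormality for every `t > 0`.

Averaging consecutive weights averages `c` with its shift, so it suffices that `1 - α n` is a
Hausdorff moment sequence for both original shifts. It equals `1 / (n + 2)` for the Schur square and
`1 - √(1 - 1 / (n + 2))` for the Bergman shift. -/

open MeasureTheory Filter Topology Finset
open scoped InnerProductSpace

/-! ## Hausdorff moment sequences -/

/-- `a` is the moment sequence of a finite measure on the unit interval. -/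
def IsHausdorffMomentSequence (a : ℕ → ℝ) : Prop :=
  ∃ μ : FiniteMeasure unitInterval, ∀ n, ∫ x, (x : ℝ) ^ n ∂(μ : Measure unitInterval) = a n

namespace IsHausdorffMomentSequence

variable {a b : ℕ → ℝ}

theorem integrable_of_continuous (μ : Measure unitInterval) [IsFiniteMeasure μ]
    {f : unitInterval → ℝ} (hf : Continuous f) : Integrable f μ :=
  hf.integrable_of_hasCompactSupport (HasCompactSupport.of_compactSpace f)

protected theorem nonneg (ha : IsHausdorffMomentSequence a) (n : ℕ) : 0 ≤ a n := by
  obtain ⟨μ, hμ⟩ := ha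
  rw [← hμ]
  exact integral_nonneg fun x => pow_nonneg x.2.1 n

protected theorem antitone (ha : IsHausdorffMomentSequence a) : Antitone a := by
  obtain ⟨μ, hμ⟩ := ha
  intro m n hmn
  rw [← hμ, ← hμ]
  exact integral_mono (integrable_of_continuous _ (by fun_prop))
    (integrable_of_continuous _ (by fun_prop))
    fun x => pow_le_pow_of_le_one x.2.1 x.2.2 hmn

protected theorem add (ha : IsHausdorffMomentSequence a) (hb : IsHausdorffMomentSequence b) :
    IsHausdorffMomentSequence fun n => a n + b n := by
  obtain ⟨μ, hμ⟩ := ha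
  obtain ⟨ν, hν⟩ := hb
  refine ⟨μ + ν, fun n => ?_⟩
  rw [FiniteMeasure.toMeasure_add, integral_add_measure
    (integrable_of_continuous _ (by fun_prop)) (integrable_of_continuous _ (by fun_prop)), hμ, hν]

protected theorem const_mul (ha : IsHausdorffMomentSequence a) {c : ℝ} (hc : 0 ≤ c) :
    IsHausdorffMomentSequence fun n => c * a n := by
  obtain ⟨μ, hμ⟩ := ha
  lift c to NNReal using hc
  refine ⟨c • μ, fun n => ?_⟩
  rw [FiniteMeasure.toMeasure_smul, integral_smul_nnreal_measure, hμ]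
  rfl

protected theorem zero : IsHausdorffMomentSequence fun _ => 0 :=
  ⟨0, fun n => by simp⟩

protected theorem geometric {r : ℝ} (h0 : 0 ≤ r) (h1 : r ≤ 1) :
    IsHausdorffMomentSequence fun n => r ^ n :=
  ⟨⟨Measure.dirac ⟨r, h0, h1⟩, inferInstance⟩, fun n => by simp⟩

protected theorem one : IsHausdorffMomentSequence fun _ => 1 := by
  simpa using IsHausdorffMomentSequence.geometric zero_le_one le_rfl

/-- The representing measure is the multiplicative convolution: the image of the product measure
under `(x, y) ↦ x * y`. -/
protected theorem mul (ha : IsHausdorffMomentSequence a) (hb : IsHausdorffMomentSequence b) :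
    IsHausdorffMomentSequence fun n => a n * b n := by
  obtain ⟨μ, hμ⟩ := ha
  obtain ⟨ν, hν⟩ := hb
  let m : unitInterval × unitInterval → unitInterval := fun p => p.1 * p.2
  have hm : Measurable m := by fun_prop
  refine ⟨⟨((μ : Measure unitInterval).prod (ν : Measure unitInterval)).map m,
    inferInstance⟩, fun n => ?_⟩
  rw [FiniteMeasure.toMeasure_mk, integral_map hm.aemeasurable
    (Continuous.aestronglyMeasurable (by fun_prop))]
  simp only [← hμ, ← hν]
  rw [← integral_prod_mul]
  simp [m, mul_pow]

protected theorem pow (ha : IsHausdorffMomentSequence a) (k : ℕ) :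
    IsHausdorffMomentSequence fun n => a n ^ k := by
  induction k with
  | zero => simpa using IsHausdorffMomentSequence.one
  | succ k ih => simpa [pow_succ] using ih.mul ha

protected theorem sum {ι : Type*} (s : Finset ι) {f : ι → ℕ → ℝ}
    (hf : ∀ i ∈ s, IsHausdorffMomentSequence (f i)) :
    IsHausdorffMomentSequence fun n => ∑ i ∈ s, f i n := by
  classical
  induction s using Finset.induction_on with
  | empty => simpa using IsHausdorffMomentSequence.zero
  | insert i s hi ih =>
    simp only [Finset.sum_insert hi]
    exact (hf i (mem_insert_self i s)).add (ih fun j hj => hf j (mem_insert_of_mem hj))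

/-- Giving the representing measure the density `x` raises every exponent by one. -/
protected theorem succ (ha : IsHausdorffMomentSequence a) :
    IsHausdorffMomentSequence fun n => a (n + 1) := by
  obtain ⟨μ, hμ⟩ := ha
  let w : unitInterval → NNReal := unitInterval.toNNReal
  have hw : Measurable w := unitInterval.toNNReal_continuous.measurable
  have : IsFiniteMeasure ((μ : Measure unitInterval).withDensity fun x => (w x : ENNReal)) := by
    refine isFiniteMeasure_withDensity (ne_top_of_le_ne_top
      (measure_ne_top (μ : Measure unitInterval) Set.univ) ?_)
    rw [← lintegral_one]
    exact lintegral_mono fun x => ENNReal.coe_le_one_iff.2 x.2.2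
  refine ⟨⟨_, this⟩, fun n => ?_⟩
  rw [FiniteMeasure.toMeasure_mk, integral_withDensity_eq_integral_smul hw]
  simp only [← hμ]
  refine integral_congr_ae (.of_forall fun x => ?_)
  simp only [NNReal.smul_def, smul_eq_mul, pow_succ']
  rfl

protected theorem shift (ha : IsHausdorffMomentSequence a) (k : ℕ) :
    IsHausdorffMomentSequence fun n => a (n + k) := by
  induction k with
  | zero => simpa using ha
  | succ k ih => simpa [add_right_comm, add_assoc] using ih.succ

/-- A pointwise limit of Hausdorff moment sequences is a Hausdorff moment sequence. -/
protected theorem of_tendsto {f : ℕ → ℕ → ℝ} (hf : ∀ k, IsHausdorffMomentSequence (f k))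
    (h : ∀ n, Tendsto (fun k => f k n) atTop (𝓝 (a n))) : IsHausdorffMomentSequence a := by
  -- The zeroth moment is the total mass, so the measures representing `f k` eventually have mass
  -- below `a 0 + 1`. Measures of bounded mass are weakly compact, hence their moment sequences form
  -- a closed set.
  let C : NNReal := (a 0 + 1).toNNReal
  have hcomp := isCompact_setOfPred_finiteMeasure_le_of_compactSpace unitInterval C
  let M : FiniteMeasure unitInterval → ℕ → ℝ := fun μ n =>
    ∫ x, (x : ℝ) ^ n ∂(μ : Measure unitInterval)
  have hM : Continuous M := continuous_pi fun n =>
    FiniteMeasure.continuous_integral_boundedContinuousFunction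
      (BoundedContinuousFunction.mkOfCompact ⟨fun x : unitInterval => (x : ℝ) ^ n, by fun_prop⟩)
  have hmem : a ∈ M '' {μ | μ.mass ≤ C} := by
    refine (hcomp.image hM).isClosed.mem_of_tendsto (tendsto_pi_nhds.2 h) ?_
    filter_upwards [(h 0).eventually (gt_mem_nhds (lt_add_one (a 0)))] with k hk
    obtain ⟨μ, hμ⟩ := hf k
    refine ⟨μ, ?_, funext hμ⟩
    have h0 := hμ 0
    simp only [pow_zero, integral_const, smul_eq_mul, mul_one] at h0
    rw [← h0] at hk
    exact NNReal.le_toNNReal_of_coe_le hk.le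
  obtain ⟨μ, -, hμ⟩ := hmem
  exact ⟨μ, fun n => congrFun hμ n⟩

protected theorem of_hasSum {f : ℕ → ℕ → ℝ} (hf : ∀ k, IsHausdorffMomentSequence (f k))
    (h : ∀ n, HasSum (fun k => f k n) (a n)) : IsHausdorffMomentSequence a :=
  .of_tendsto (fun k => .sum (range k) fun i _ => hf i) fun n => (h n).tendsto_sum_nat

protected theorem exp (ha : IsHausdorffMomentSequence a) :
    IsHausdorffMomentSequence fun n => Real.exp (a n) := by
  refine .of_hasSum (f := fun k n => (k.factorial : ℝ)⁻¹ * a n ^ k)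
    (fun k => (ha.pow k).const_mul (by positivity)) fun n => ?_
  simpa [div_eq_inv_mul, Real.exp_eq_exp_ℝ] using NormedSpace.expSeries_div_hasSum_exp (a n)

/-- The series `∑ a ^ (k + 1) / (k + 1)` has nonnegative coefficients; it converges at every `n`
because `0 ≤ a n ≤ a 0 < 1`. -/
protected theorem neg_log_one_sub (ha : IsHausdorffMomentSequence a) (h1 : a 0 < 1) :
    IsHausdorffMomentSequence fun n => -Real.log (1 - a n) := by
  refine .of_hasSum (f := fun k n => ((k : ℝ) + 1)⁻¹ * a n ^ (k + 1))
    (fun k => (ha.pow (k + 1)).const_mul (by positivity)) fun n => ?_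
  have h : |a n| < 1 := by
    rw [abs_of_nonneg (ha.nonneg n)]
    exact (ha.antitone n.zero_le).trans_lt h1
  simpa [div_eq_inv_mul] using Real.hasSum_pow_div_log_of_abs_lt_one h

/-- `1 - √(1 - a)` is the limit of the iteration `g ↦ (a + g ^ 2) / 2` started at `0`. -/
protected theorem one_sub_sqrt_one_sub (ha : IsHausdorffMomentSequence a) (h1 : a 0 ≤ 1) :
    IsHausdorffMomentSequence fun n => 1 - √(1 - a n) := by
  -- Each iterate arises from `a` by sums, squares and nonnegative multiples, so it stays in the
  -- cone.
  let g : ℕ → ℕ → ℝ := fun k => Nat.rec (fun _ => 0) (fun _ g n => 1 / 2 * (a n + g n ^ 2)) k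
  have gs : ∀ k n, g (k + 1) n = 1 / 2 * (a n + g k n ^ 2) := fun k n => rfl
  refine .of_tendsto (f := g) (fun k => ?_) fun n => ?_
  · induction k with
    | zero => exact .zero
    | succ k ih => exact (ha.add (ih.pow 2)).const_mul (by norm_num)
  have hn0 := ha.nonneg n
  have hn1 : a n ≤ 1 := (ha.antitone n.zero_le).trans h1
  set s := √(1 - a n) with hs
  have hs0 : 0 ≤ s := Real.sqrt_nonneg _
  have hss : s ^ 2 = 1 - a n := Real.sq_sqrt (by linarith)
  have g0 : ∀ k, 0 ≤ g k n := by
    intro k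
    cases k with
    | zero => exact le_rfl
    | succ k => rw [gs]; positivity
  have g1 : ∀ k, g k n ≤ 1 - s := by
    intro k
    induction k with
    | zero =>
      change 0 ≤ 1 - s
      nlinarith
    | succ k ih =>
      rw [gs]
      have := pow_le_pow_left₀ (g0 k) ih 2
      nlinarith
  have gm : Monotone fun k => g k n := by
    refine monotone_nat_of_le_succ fun k => ?_
    induction k with
    | zero => exact g0 1
    | succ k ih =>
      rw [gs, gs (k + 1)]
      have := pow_le_pow_left₀ (g0 k) ih 2
      linarith
  have hlim := tendsto_atTop_ciSup gm ⟨1 - s, by rintro _ ⟨k, rfl⟩; exact g1 k⟩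
  set l := ⨆ k, g k n
  have hl1 : l ≤ 1 - s := ciSup_le g1
  have hfix : l = 1 / 2 * (a n + l ^ 2) := by
    refine tendsto_nhds_unique (hlim.comp (tendsto_add_atTop_nat 1)) ?_
    exact ((hlim.pow 2).const_add (a n)).const_mul (1 / 2)
  -- The fixed points are `1 ± s`; the bound `l ≤ 1 - s` selects the smaller.
  have hl : l = 1 - s := by nlinarith
  rwa [hl] at hlim

/-- If `d` is a Hausdorff moment sequence, so is `n ↦ exp (-∑ k < n, d k)`. -/
protected theorem exp_neg_sum_range (ha : IsHausdorffMomentSequence a) :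
    IsHausdorffMomentSequence fun n => Real.exp (-∑ k ∈ range n, a k) := by
  -- The series of `a` may diverge, so it is damped by `r m ^ k` with `r m < 1`, and `r m → 1` at
  -- the end.
  let r : ℕ → ℝ := fun m => 1 - 1 / ((m : ℝ) + 1)
  have hr0 : ∀ m, 0 ≤ r m := fun m => by
    have : 1 / ((m : ℝ) + 1) ≤ 1 := by
      rw [div_le_one (by positivity)]
      linarith [(Nat.cast_nonneg m : (0 : ℝ) ≤ m)]
    simp only [r]
    linarith
  have hr1 : ∀ m, r m < 1 := fun m => by
    have : 0 < 1 / ((m : ℝ) + 1) := by positivity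
    simp only [r]
    linarith
  have hr : Tendsto r atTop (𝓝 1) := by
    simpa [r] using tendsto_one_div_add_atTop_nhds_zero_nat (𝕜 := ℝ).const_sub 1
  refine .of_tendsto (f := fun m n => Real.exp (-∑ k ∈ range n, a k * r m ^ k)) (fun m => ?_)
    fun n => ?_
  · let u : ℕ → ℝ := fun k => a k * r m ^ k
    have hu : IsHausdorffMomentSequence u := ha.mul (.geometric (hr0 m) (hr1 m).le)
    have hus : Summable u := by
      refine Summable.of_nonneg_of_le hu.nonneg (fun k => ?_)
        ((summable_geometric_of_lt_one (hr0 m) (hr1 m)).mul_left (a 0))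
      exact mul_le_mul_of_nonneg_right (ha.antitone k.zero_le) (pow_nonneg (hr0 m) k)
    have htail : IsHausdorffMomentSequence fun n => ∑' k, u (k + n) := by
      refine .of_hasSum (f := fun k n => u (n + k)) (fun k => hu.shift k) fun n => ?_
      simpa only [add_comm n] using ((summable_nat_add_iff n).2 hus).hasSum
    -- Minus a partial sum is the tail minus the full sum. The tail is a Hausdorff moment sequence
    -- in `n`, and the full sum contributes only a positive constant factor.
    convert htail.exp.const_mul (Real.exp_nonneg (-∑' k, u k)) using 2 with n
    rw [← Real.exp_add, ← hus.sum_add_tsum_nat_add n]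
    congr 1
    ring
  · have : Tendsto (fun m => ∑ k ∈ range n, a k * r m ^ k) atTop
        (𝓝 (∑ k ∈ range n, a k * 1 ^ k)) :=
      tendsto_finsetSum _ fun k _ => (hr.pow k).const_mul (a k)
    simp only [one_pow, mul_one] at this
    exact (Real.continuous_exp.tendsto _).comp this.neg

theorem inv_succ : IsHausdorffMomentSequence fun n => 1 / ((n : ℝ) + 1) := by
  refine ⟨⟨volume, inferInstance⟩, fun n => ?_⟩
  rw [FiniteMeasure.toMeasure_mk]
  have h : ∫ x : unitInterval, (x : ℝ) ^ n = ∫ x in Set.Icc (0 : ℝ) 1, x ^ n :=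
    integral_subtype measurableSet_Icc fun x : ℝ => x ^ n
  rw [h, integral_Icc_eq_integral_Ioc, ← intervalIntegral.integral_of_le zero_le_one, integral_pow]
  simp

end IsHausdorffMomentSequence

/-! ## The mean transform of a weighted shift -/

@[simp]
theorem weightedShift_apply_zero (α : WeightSequence) (x : EllTwo) : weightedShift α x 0 = 0 := rfl

@[simp]
theorem weightedShift_apply_succ (α : WeightSequence) (x : EllTwo) (n : ℕ) :
    weightedShift α x (n + 1) = (α.weight n : ℂ) * x n := rfl

namespace WeightSequence

/-- The constant weight sequence `1`, whose weighted shift is the unilateral shift. -/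
noncomputable def one : WeightSequence where
  weight _ := 1
  pos _ := one_pos
  bddAbove := ⟨1, by rintro _ ⟨n, rfl⟩; exact le_rfl⟩

/-- The averages of consecutive weights. -/
noncomputable def average (α : WeightSequence) : WeightSequence where
  weight n := (α.weight n + α.weight (n + 1)) / 2
  pos n := by
    have := α.pos n
    have := α.pos (n + 1)
    positivity
  bddAbove := by
    obtain ⟨C, hC⟩ := α.bddAbove
    refine ⟨C, ?_⟩
    rintro _ ⟨n, rfl⟩
    have h1 : α.weight n ≤ C := hC ⟨n, rfl⟩
    have h2 : α.weight (n + 1) ≤ C := hC ⟨n + 1, rfl⟩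
    simp only
    linarith

end WeightSequence

namespace IsPolarDecomposition

universe u

variable {H : Type u} [NormedAddCommGroup H] [InnerProductSpace ℂ H] [CompleteSpace H]
  {T U D : H →L[ℂ] H}

/-- Since `T* T = D U* U D = D ^ 2`, uniqueness of the positive square root applies. -/
theorem _root_.cfcAbs_eq_of_mul_eq (hD : 0 ≤ D) (hU : star U * U = 1) (h : U * D = T) :
    CFC.abs T = D := by
  refine CFC.sqrt_unique ?_ hD
  have hs : star D = D := hD.isSelfAdjoint
  rw [← h, star_mul, hs, mul_assoc, ← mul_assoc (star U), hU, one_mul]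

/-- An injective operator `T = U D` with `D ≥ 0` and `U` an isometry has the polar decomposition
`T = U D`. -/
theorem of_mul_eq (hD : 0 ≤ D) (hU : star U * U = 1) (h : U * D = T) (hT : T.ker = ⊥) :
    IsPolarDecomposition T U where
  eq_mul := by rw [cfcAbs_eq_of_mul_eq hD hU h, h]
  ker_eq := by
    rw [hT, LinearMap.ker_eq_bot']
    intro x hx
    have hx' : U x = 0 := hx
    have := congrArg (fun A : H →L[ℂ] H => A x) hU
    simpa [hx'] using this.symm
  norm_map x _ := by
    have h1 := congrArg (fun A : H →L[ℂ] H => ⟪A x, x⟫_ℂ) hU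
    simp only [mul_apply_eq_comp, ContinuousLinearMap.star_eq_adjoint,
      ContinuousLinearMap.adjoint_inner_left, one_apply_eq_self] at h1
    rw [norm_eq_sqrt_re_inner (𝕜 := ℂ), h1, ← norm_eq_sqrt_re_inner]

theorem _root_.meanTransform_eq_of_mul_eq (hD : 0 ≤ D) (hU : star U * U = 1) (h : U * D = T)
    (hT : T.ker = ⊥) : meanTransform T = (1 / 2 : ℂ) • (T + D * U) := by
  have hp : polarPartialIsometry T = U := (existsUnique_isPolarDecomposition T).unique
    (isPolarDecomposition_polarPartialIsometry T) (of_mul_eq hD hU h hT)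
  rw [meanTransform, hp, cfcAbs_eq_of_mul_eq hD hU h, h]

end IsPolarDecomposition

/-- The unilateral shift. -/
noncomputable def unilateralShift : EllTwo →L[ℂ] EllTwo := weightedShift WeightSequence.one

theorem unilateralShift_single (n : ℕ) :
    unilateralShift (lp.single 2 n (1 : ℂ)) = lp.single 2 (n + 1) (1 : ℂ) := by
  rw [unilateralShift, weightedShift_single]
  simp [WeightSequence.one]

theorem hasSum_inner_ellTwo (x y : EllTwo) : HasSum (fun n => ⟪x n, y n⟫_ℂ) ⟪x, y⟫_ℂ :=
  lp.hasSum_inner (𝕜 := ℂ) (G := fun _ : ℕ => ℂ) x y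

theorem inner_unilateralShift (x y : EllTwo) :
    ⟪unilateralShift x, unilateralShift y⟫_ℂ = ⟪x, y⟫_ℂ := by
  have h := hasSum_inner_ellTwo (unilateralShift x) (unilateralShift y)
  rw [← h.tsum_eq, h.summable.tsum_eq_zero_add, ← (hasSum_inner_ellTwo x y).tsum_eq]
  simp [unilateralShift, WeightSequence.one]

theorem star_unilateralShift_mul_self : star unilateralShift * unilateralShift = 1 := by
  ext1 x
  refine ext_inner_right ℂ fun y => ?_
  simp [ContinuousLinearMap.star_eq_adjoint, ContinuousLinearMap.adjoint_inner_left,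
    inner_unilateralShift]

theorem star_unilateralShift_single_succ (n : ℕ) :
    star unilateralShift (lp.single 2 (n + 1) (1 : ℂ)) = lp.single 2 n (1 : ℂ) := by
  rw [← unilateralShift_single, ← mul_apply_eq_comp,
    star_unilateralShift_mul_self]
  rfl

/-- Bounded operators on `ℓ²` that agree on the standard basis are equal. -/
theorem EllTwo.ext_single {E : Type*} [NormedAddCommGroup E] [NormedSpace ℂ E]
    {A B : EllTwo →L[ℂ] E}
    (h : ∀ n, A (lp.single 2 n (1 : ℂ)) = B (lp.single 2 n (1 : ℂ))) : A = B := by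
  refine lp.ext_continuousLinearMap (by norm_num) fun n => ?_
  ext
  simpa using h n

/-- The diagonal factor is realised as `D = S* W_α`, which avoids constructing diagonal operators
separately. -/
theorem unilateralShift_mul_star_mul_weightedShift (α : WeightSequence) :
    unilateralShift * (star unilateralShift * weightedShift α) = weightedShift α := by
  refine EllTwo.ext_single fun n => ?_
  simp only [mul_apply_eq_comp, weightedShift_single, map_smul,
    star_unilateralShift_single_succ, unilateralShift_single]

/-- The quadratic form of `S* W_α` is `∑ α n * ‖x n‖ ^ 2`. -/
theorem star_unilateralShift_mul_weightedShift_nonneg (α : WeightSequence) :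
    0 ≤ star unilateralShift * weightedShift α := by
  rw [ContinuousLinearMap.nonneg_iff_isPositive, ContinuousLinearMap.isPositive_iff_complex]
  intro x
  have h1 : HasSum (fun n => ((α.weight n * ‖x n‖ ^ 2 : ℝ) : ℂ))
      ⟪(star unilateralShift * weightedShift α) x, x⟫_ℂ := by
    rw [mul_apply_eq_comp, ContinuousLinearMap.star_eq_adjoint,
      ContinuousLinearMap.adjoint_inner_left]
    have h := (hasSum_nat_add_iff' 1).2
      (hasSum_inner_ellTwo (weightedShift α x) (unilateralShift x))
    rw [Finset.sum_range_one, weightedShift_apply_zero, inner_zero_left, sub_zero] at h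
    have he : ∀ n, ⟪weightedShift α x (n + 1), unilateralShift x (n + 1)⟫_ℂ =
        ((α.weight n * ‖x n‖ ^ 2 : ℝ) : ℂ) := fun n => by
      simp [unilateralShift, WeightSequence.one, Complex.mul_conj', mul_left_comm]
    simpa only [he] using h
  have h2 : HasSum (fun n => α.weight n * ‖x n‖ ^ 2)
      (RCLike.re ⟪(star unilateralShift * weightedShift α) x, x⟫_ℂ) := Complex.hasSum_re h1
  exact ⟨((Complex.hasSum_ofReal.2 h2).unique h1),
    h2.nonneg fun n => mul_nonneg (α.pos n).le (sq_nonneg _)⟩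

theorem weightedShift_ker (α : WeightSequence) : (weightedShift α).ker = ⊥ := by
  rw [LinearMap.ker_eq_bot']
  intro x hx
  ext n
  have h : weightedShift α x (n + 1) = 0 := by
    have : weightedShift α x = 0 := hx
    rw [this]
    rfl
  simpa [(α.pos n).ne'] using h

/-- On `e n`, the product `S D` has weight `α n`, while `D S` shifts first and so has weight `α (n +
1)`. -/
theorem meanTransform_weightedShift (α : WeightSequence) :
    meanTransform (weightedShift α) = weightedShift α.average := by
  rw [meanTransform_eq_of_mul_eq (star_unilateralShift_mul_weightedShift_nonneg α)
    star_unilateralShift_mul_self (unilateralShift_mul_star_mul_weightedShift α)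
    (weightedShift_ker α)]
  refine EllTwo.ext_single fun n => ?_
  simp only [smul_apply, add_apply,
    mul_apply_eq_comp, unilateralShift_single, weightedShift_single, map_smul,
    star_unilateralShift_single_succ, ← add_smul, smul_smul]
  congr 1
  simp [WeightSequence.average]
  ring

/-! ## Multiplication operators and subnormality of weighted shifts -/

section Multiplication

variable {X : Type*} [MeasurableSpace X] {μ : Measure X}

/-- Multiplication by a bounded function on `L²`. -/
noncomputable def mulOperator (φ : Lp ℂ ⊤ μ) : Lp ℂ 2 μ →L[ℂ] Lp ℂ 2 μ :=
  (ContinuousLinearMap.mul ℂ ℂ).holderL μ ⊤ 2 2 φ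

theorem coeFn_mulOperator (φ : Lp ℂ ⊤ μ) (f : Lp ℂ 2 μ) :
    mulOperator φ f =ᵐ[μ] fun x => φ x * f x :=
  (ContinuousLinearMap.mul ℂ ℂ).coeFn_holder φ f

theorem star_mulOperator (φ : Lp ℂ ⊤ μ) : star (mulOperator φ) = mulOperator (star φ) := by
  symm
  rw [ContinuousLinearMap.star_eq_adjoint, ContinuousLinearMap.eq_adjoint_iff]
  intro f g
  rw [L2.inner_def, L2.inner_def]
  refine integral_congr_ae ?_
  filter_upwards [coeFn_mulOperator (star φ) f, coeFn_mulOperator φ g, Lp.coeFn_star φ]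
    with x h1 h2 h3
  rw [h1, h2, h3]
  simp only [Pi.star_apply, RCLike.inner_apply, map_mul, RCLike.star_def, RCLike.conj_conj]
  ring

instance isStarNormal_mulOperator (φ : Lp ℂ ⊤ μ) : IsStarNormal (mulOperator φ) := by
  rw [isStarNormal_iff, star_mulOperator]
  ext f
  simp only [mul_apply_eq_comp]
  filter_upwards [coeFn_mulOperator φ f, coeFn_mulOperator (star φ) f,
    coeFn_mulOperator φ (mulOperator (star φ) f), coeFn_mulOperator (star φ) (mulOperator φ f)]
    with x h1 h2 h3 h4
  rw [h3, h4, h1, h2]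
  ring

end Multiplication

/-- A weighted shift is subnormal if a normal operator `N` has orthonormal vectors `v n` with
`N (v n) = α n • v (n + 1)`. -/
theorem isSubnormalOperator_weightedShift_of_orthonormal (α : WeightSequence) {K : Type}
    [NormedAddCommGroup K] [InnerProductSpace ℂ K] [CompleteSpace K] (N : K →L[ℂ] K)
    [hN : IsStarNormal N] {v : ℕ → K} (hv : Orthonormal ℂ v)
    (h : ∀ n, N (v n) = (α.weight n : ℂ) • v (n + 1)) :
    IsSubnormalOperator (weightedShift α) := by
  let V : EllTwo →ₗᵢ[ℂ] K := hv.orthogonalFamily.linearIsometry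
  have hV : ∀ n, V (lp.single 2 n (1 : ℂ)) = v n := fun n => by
    simp [V, OrthogonalFamily.linearIsometry_apply_single]
  refine ⟨K, _, _, _, N, V, hN, fun x => ?_⟩
  have key : N ∘L V.toContinuousLinearMap = V.toContinuousLinearMap ∘L weightedShift α := by
    refine EllTwo.ext_single fun n => ?_
    simp [weightedShift_single, hV, h]
  exact congrArg (fun A : EllTwo →L[ℂ] K => A x) key

theorem fourier_one_pow {T : ℝ} (n : ℕ) (θ : AddCircle T) :
    (fourier 1 θ : ℂ) ^ n = fourier (n : ℤ) θ := by
  induction n with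
  | zero => simp
  | succ n ih => rw [pow_succ, ih, ← fourier_add, Nat.cast_succ]

theorem integral_fourier_neg (n : ℤ) :
    ∫ θ : UnitAddCircle, (fourier (-n) θ : ℂ) • (1 : ℂ) ∂AddCircle.haarAddCircle =
      if n = 0 then 1 else 0 := by
  have h := congrFun (fourierCoeff_fourier (T := 1) 0) n
  simpa [fourierCoeff, Pi.single_apply] using h

/-- One half of Berger's theorem: a weighted shift whose moments form a Hausdorff moment sequence
is subnormal. -/
theorem isSubnormalOperator_weightedShift (α : WeightSequence)
    (hα : IsHausdorffMomentSequence fun n => ∏ k ∈ Finset.range n, α.weight k ^ 2) :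
    IsSubnormalOperator (weightedShift α) := by
  obtain ⟨μ, hμ⟩ := hα
  -- In polar coordinates the normal operator is multiplication by `φ = √x * e^(2πiθ)`. The circle
  -- factor makes distinct powers of `φ` orthogonal; the square root turns `‖φ ^ n‖ ^ 2` into the
  -- `n`-th moment of `μ`.
  let ν : Measure (unitInterval × UnitAddCircle) :=
    (μ : Measure unitInterval).prod AddCircle.haarAddCircle
  let φ : C(unitInterval × UnitAddCircle, ℂ) :=
    ⟨fun p => (√(p.1 : ℝ) : ℂ) * fourier 1 p.2, by fun_prop⟩
  let p : ℕ → ℝ := fun n => ∏ k ∈ Finset.range n, α.weight k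
  have hp : ∀ n, 0 < p n := fun n => Finset.prod_pos fun k _ => α.pos k
  have hps : ∀ n, p (n + 1) = p n * α.weight n := fun n => Finset.prod_range_succ _ _
  -- The `n`-th moment is `p n ^ 2`, so division by `p n` normalises `φ ^ n`.
  let w : ℕ → C(unitInterval × UnitAddCircle, ℂ) := fun n => ((p n)⁻¹ : ℂ) • φ ^ n
  let v : ℕ → Lp ℂ 2 ν := fun n => ContinuousMap.toLp 2 ν ℂ (w n)
  have hw : ∀ n q, w n q = ((p n)⁻¹ : ℂ) * φ q ^ n := fun _ _ => rfl
  have hv : Orthonormal ℂ v := by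
    rw [orthonormal_iff_ite]
    intro m n
    rw [ContinuousMap.inner_toLp]
    have h1 : ∀ q : unitInterval × UnitAddCircle, w n q * (starRingEnd ℂ) (w m q) =
        (((p m)⁻¹ * (p n)⁻¹ * (√(q.1 : ℝ)) ^ (m + n) : ℝ) : ℂ) *
          (fourier (-((m : ℤ) - n)) q.2 • (1 : ℂ)) := by
      intro q
      rw [hw, hw, show φ q = (√(q.1 : ℝ) : ℂ) * fourier 1 q.2 from rfl, neg_sub, sub_eq_add_neg,
        fourier_add, fourier_neg, ← fourier_one_pow, ← fourier_one_pow]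
      simp only [map_mul, map_pow, map_inv₀, Complex.conj_ofReal, smul_eq_mul]
      push_cast
      ring
    simp_rw [h1]
    rw [integral_prod_mul (μ := (μ : Measure unitInterval))
      (fun x : unitInterval => (((p m)⁻¹ * (p n)⁻¹ * (√(x : ℝ)) ^ (m + n) : ℝ) : ℂ))
      (fun θ : UnitAddCircle => fourier (-((m : ℤ) - n)) θ • (1 : ℂ)), integral_complex_ofReal,
      integral_fourier_neg, integral_const_mul]
    by_cases hmn : m = n
    · subst hmn
      have h2 : ∀ x : unitInterval, √(x : ℝ) ^ (m + m) = (x : ℝ) ^ m := fun x => by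
        rw [← two_mul, pow_mul, Real.sq_sqrt x.2.1]
      simp_rw [h2, hμ, Finset.prod_pow]
      have := (hp m).ne'
      have h3 : (p m)⁻¹ * (p m)⁻¹ * p m ^ 2 = 1 := by field_simp
      rw [if_pos (sub_self _), if_pos trivial, mul_one]
      exact_mod_cast h3
    · rw [if_neg (by omega), if_neg hmn, mul_zero]
  refine isSubnormalOperator_weightedShift_of_orthonormal α
    (mulOperator (ContinuousMap.toLp ⊤ ν ℂ φ)) hv fun n => ?_
  ext
  filter_upwards [coeFn_mulOperator (ContinuousMap.toLp ⊤ ν ℂ φ) (v n),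
    ContinuousMap.coeFn_toLp (p := ⊤) (𝕜 := ℂ) ν φ,
    ContinuousMap.coeFn_toLp (p := 2) (𝕜 := ℂ) ν (w n),
    ContinuousMap.coeFn_toLp (p := 2) (𝕜 := ℂ) ν (w (n + 1)),
    Lp.coeFn_smul (α.weight n : ℂ) (v (n + 1))] with q h1 h2 h3 h4 h5
  rw [h1, h5, Pi.smul_apply, h2, h3, h4]
  have hp0 : (p n : ℂ) ≠ 0 := Complex.ofReal_ne_zero.2 (hp n).ne'
  have hα0 : (α.weight n : ℂ) ≠ 0 := Complex.ofReal_ne_zero.2 (α.pos n).ne'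
  rw [hw, smul_eq_mul, hw, hps, pow_succ]
  push_cast
  field_simp

/-! ## Moment infinitely divisible weighted shifts -/

/-- A weighted shift with weights `1 - c n` is moment infinitely divisible if `c` is a Hausdorff
moment sequence. -/
theorem isMomentInfinitelyDivisible_weightedShift (β : WeightSequence)
    (h : IsHausdorffMomentSequence fun n => 1 - β.weight n) :
    IsMomentInfinitelyDivisible (weightedShift β) := by
  refine ⟨β, rfl, fun t ht => isSubnormalOperator_weightedShift _ ?_⟩
  -- Positivity of `β 0` is the condition `c 0 < 1`. The factor `2 * t` combines the power `t` with
  -- the squaring of weights in the moments.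
  have hd := ((h.neg_log_one_sub (by linarith [β.pos 0])).const_mul
    (by positivity : 0 ≤ 2 * t)).exp_neg_sum_range
  convert hd using 2 with n
  rw [← sum_neg_distrib, Real.exp_sum]
  refine prod_congr rfl fun k _ => ?_
  have hk := β.pos k
  change (β.weight k ^ t) ^ 2 = _
  rw [sub_sub_cancel, ← Real.rpow_mul_natCast hk.le, Real.rpow_def_of_pos hk]
  congr 1
  push_cast
  ring

theorem IsMomentInfinitelyDivisible.isSubnormalOperator {T : EllTwo →L[ℂ] EllTwo}
    (hT : IsMomentInfinitelyDivisible T) : IsSubnormalOperator T := by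
  obtain ⟨β, rfl, hβ⟩ := hT
  have h : β.rpow 1 one_pos = β := by
    cases β
    simp [WeightSequence.rpow]
  simpa only [h] using hβ 1 one_pos

/-- If `1 - α n` is a Hausdorff moment sequence, then the mean transform of the weighted shift
`W_α` is moment infinitely divisible. -/
theorem isMomentInfinitelyDivisible_meanTransform (α : WeightSequence)
    (h : IsHausdorffMomentSequence fun n => 1 - α.weight n) :
    IsMomentInfinitelyDivisible (meanTransform (weightedShift α)) := by
  rw [meanTransform_weightedShift]
  refine isMomentInfinitelyDivisible_weightedShift _ ?_
  convert (h.add h.succ).const_mul (by norm_num : (0 : ℝ) ≤ 1 / 2) using 2 with n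
  simp only [WeightSequence.average]
  ring

namespace IsHausdorffMomentSequence

/-- The weight is `√(1 - 1 / (n + 2))`, and `1 / (n + 2)` is the shifted moment sequence of Lebesgue
measure. -/
theorem one_sub_bergman :
    IsHausdorffMomentSequence fun n => 1 - WeightSequence.bergman.weight n := by
  convert inv_succ.succ.one_sub_sqrt_one_sub (by norm_num) using 3 with n
  simp only [WeightSequence.bergman]
  congr 1
  push_cast
  field_simp
  ring

theorem one_sub_bergman_schurSquare :
    IsHausdorffMomentSequence fun n => 1 - WeightSequence.bergman.schurSquare.weight n := by
  convert inv_succ.succ using 2 with n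
  simp only [WeightSequence.schurSquare, WeightSequence.bergman]
  rw [Real.sq_sqrt (by positivity)]
  push_cast
  field_simp
  ring

end IsHausdorffMomentSequence

theorem corollary3p8 :
    (IsMomentInfinitelyDivisible (meanTransform bergmanShift) ∧
      IsSubnormalOperator (meanTransform bergmanShift)) ∧
    (IsMomentInfinitelyDivisible (meanTransform bergmanShiftSchurSquare) ∧
      IsSubnormalOperator (meanTransform bergmanShiftSchurSquare)) := by
  have h1 : IsMomentInfinitelyDivisible (meanTransform bergmanShift) :=
    isMomentInfinitelyDivisible_meanTransform _ .one_sub_bergman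
  have h2 : IsMomentInfinitelyDivisible (meanTransform bergmanShiftSchurSquare) :=
    isMomentInfinitelyDivisible_meanTransform _ .one_sub_bergman_schurSquare
  exact ⟨⟨h1, h1.isSubnormalOperator⟩, h2, h2.isSubnormalOperator⟩
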